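/- **Theorem (Weyl's criterion for finite-state dimension).** Let $\Sigma=\{0,1\}$, let $\Sigma^\infty$ be the space of infinite binary sequences with the left shift $T$, let $\mathbb{T}=\mathbb{R}/\mathbb{Z}$, and let $v:\Sigma^\infty\to\mathbb{T}$, $v(x)=\sum_{i\ge 0}x_i2^{-(i+1)} \bmod 1$. For $w\in\Sigma^l$ let $C_w\subseteq\Sigma^\infty$ be the set of sequences with prefix $w$ and let $I_w\subseteq\mathbb{T}$ be the image of $[a_w,a_w+2^{-l})$, where $a_w=\sum_{i<l}w_i2^{-(i+1)}$. The *lift* $\hat\mu$ of a probability measure $\mu$ on $\mathbb{T}$ is the unique probability measure on $\Sigma^\infty$ with $\hat\mu(C_w)=\mu(I_w)$ for every finite string $w$. For $x\in\Sigma^\infty$, $l\ge 1$ and $w\in\Sigma^l$ let $P(x_0^{n-1},w)=\frac{|\{0\le i\le n-l\,:\,x_i\cdots x_{i+l-1}=w\}|}{n-l+1}$ (for $n\ge l$), and let $$H_l(x_0^{n-1})=-\frac1l\sum_{w\in\Sigma^l}P(x_0^{n-1},w)\log_2P(x_0^{n-1},w),$$ $$\dim_{FS}(x)=\inf_{l\ge1}\liminf_{n\to\infty}H_l(x_0^{n-1}),\qquad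 \mathrm{Dim}_{FS}(x)=\inf_{l\ge1}\limsup_{n\to\infty}H_l(x_0^{n-1}).$$ For a probability measure $\nu$ on $\Sigma^\infty$ let $\mathbf{H}_n(\nu)=-\sum_{w\in\Sigma^n}\nu(C_w)\log_2\nu(C_w)$, $H^-(\nu)=\liminf_{n\to\infty}\mathbf{H}_n(\nu)/n$ and $H^+(\nu)=\limsup_{n\to\infty}\mathbf{H}_n(\nu)/n$ (with $0\log_2 0=0$ throughout). Let $x\in\Sigma^\infty$. 1. If $n_0<n_1<n_2<\cdots$ are natural numbers and $(c_k)_{k\in\mathbb{Z}}$ are complex numbers such that $$\lim_{m\to\infty}\frac1{n_m}\sum_{j=0}^{n_m-1}e^{2\pi i k\,v(T^jx)}=c_k\quad\text{for every }k\in\mathbb{Z},$$ then there is a probability measure $\mu$ on $\mathbb{T}$ such that $c_k=\int e^{2\pi i k y}\,d\mu(y)$ for every $k\in\mathbb{Z}$. 2. Let $\widehat{\mathcal{W}}_x$ be the set of the lifts $\hat\mu$ of all probability measures $\mu$ on $\mathbb{T}$ for which there are $n_0<n_1<\cdots$ such that $\lim_{m\to\infty}\frac1{n_m}\sum_{j=0}^{n_m-1}e^{2\pi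 i k\,v(T^jx)}=\int e^{2\pi i ky}\,d\mu(y)$ for every $k\in\mathbb{Z}$. Then $\widehat{\mathcal{W}}_x$ is non-empty and $$\dim_{FS}(x)=\inf\{H^-(\hat\mu)\mid\hat\mu\in\widehat{\mathcal{W}}_x\},\qquad \mathrm{Dim}_{FS}(x)=\sup\{H^+(\hat\mu)\mid\hat\mu\in\widehat{\mathcal{W}}_x\}.$$ -/

import Mathlib

open MeasureTheory Filter Topology

noncomputable section

namespace WeylFSD

/-- The Cantor space of infinite binary sequences (product topology, product Borel σ-algebra). -/
abbrev CantorSpace : Type := ℕ → Fin 2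

/-- The one-dimensional torus. -/
abbrev Torus : Type := UnitAddCircle

/-- Binary strings of length `l`. -/
abbrev Word (l : ℕ) : Type := Fin l → Fin 2

/-- The cylinder of all infinite sequences with prefix `w`. -/
def cyl {l : ℕ} (w : Word l) : Set CantorSpace := {y | ∀ i : Fin l, y i = w i}

/-- The left shift `x₀x₁x₂… ↦ x₁x₂x₃…`. -/
def shift (x : CantorSpace) : CantorSpace := fun i => x (i + 1)

/-- The evaluation map `x ↦ ∑ xᵢ / 2 ^ (i + 1) mod 1`. -/
def val (x : CantorSpace) : Torus := ((Real.ofDigits x : ℝ) : UnitAddCircle)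

/-- The real number `0.w₀w₁…` in base two. -/
def wordVal {l : ℕ} (w : Word l) : ℝ := ∑ i : Fin l, ((w i : ℕ) : ℝ) / 2 ^ ((i : ℕ) + 1)

/-- The half-open dyadic interval of the torus that belongs to `w`. -/
def dyadic {l : ℕ} (w : Word l) : Set Torus :=
  (fun r : ℝ => (r : UnitAddCircle)) '' Set.Ico (wordVal w) (wordVal w + (1 / 2) ^ l)

/-! ### The lift of a measure from the torus to Cantor space -/

lemma wordVal_restrict (x : CantorSpace) (l : ℕ) :
    wordVal (fun i : Fin l => x i) = ∑ i ∈ Finset.range l, Real.ofDigitsTerm x i := by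
  rw [wordVal, Finset.sum_range]
  rfl

lemma wordVal_nonneg {l : ℕ} (w : Word l) : 0 ≤ wordVal w :=
  Finset.sum_nonneg fun _ _ => by positivity

lemma exists_extension {l : ℕ} (w : Word l) : ∃ x : CantorSpace, (fun i : Fin l => x i) = w :=
  ⟨fun i => if h : i < l then w ⟨i, h⟩ else 0, by funext i; simp⟩

lemma wordVal_add_le_one {l : ℕ} (w : Word l) : wordVal w + (1 / 2) ^ l ≤ 1 := by
  obtain ⟨x, rfl⟩ := exists_extension w
  rw [wordVal_restrict]
  induction l with
  | zero => simp
  | succ l h1 =>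
    have h2 : Real.ofDigitsTerm x l ≤ (1 / 2) ^ (l + 1) := by
      refine (Real.ofDigitsTerm_le).trans (le_of_eq ?_)
      rw [one_div, inv_pow]
      norm_num
    rw [Finset.sum_range_succ]
    have h3 : (1 / 2 : ℝ) ^ (l + 1) = (1 / 2) ^ l / 2 := by ring
    linarith

lemma digits_mem_Ico {r : ℝ} (hr : r ∈ Set.Ico (0 : ℝ) 1) (l : ℕ) :
    (∑ i ∈ Finset.range l, Real.ofDigitsTerm (Real.digits r 2) i) ≤ r ∧
      r < (∑ i ∈ Finset.range l, Real.ofDigitsTerm (Real.digits r 2) i) + (1 / 2) ^ l := by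
  have h := Real.ofDigits_digits_sum_eq (b := 2) hr l
  have h1 := Nat.floor_le (a := ((2 : ℕ) : ℝ) ^ l * r) (by have := hr.1; positivity)
  have h2 := Nat.lt_floor_add_one (((2 : ℕ) : ℝ) ^ l * r)
  rw [← h] at h1 h2
  have hp : (0 : ℝ) < ((2 : ℕ) : ℝ) ^ l := by positivity
  refine ⟨le_of_mul_le_mul_left h1 hp, lt_of_mul_lt_mul_left (lt_of_lt_of_eq h2 ?_) hp.le⟩
  rw [mul_add, ← mul_pow]
  norm_num

lemma digits_eq_iff {r : ℝ} (hr : r ∈ Set.Ico (0 : ℝ) 1) (x : CantorSpace) (l : ℕ) :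
    (∀ i < l, Real.digits r 2 i = x i) ↔
      r ∈ Set.Ico (∑ i ∈ Finset.range l, Real.ofDigitsTerm x i)
        ((∑ i ∈ Finset.range l, Real.ofDigitsTerm x i) + (1 / 2) ^ l) := by
  induction l with
  | zero => simpa using hr
  | succ l ih =>
    have hsum : (∀ i < l, Real.digits r 2 i = x i) →
        ∑ i ∈ Finset.range l, Real.ofDigitsTerm x i =
          ∑ i ∈ Finset.range l, Real.ofDigitsTerm (Real.digits r 2) i := fun h =>
      Finset.sum_congr rfl fun i hi => by
        simp [Real.ofDigitsTerm, h i (Finset.mem_range.mp hi)]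
    have hd := digits_mem_Ico hr (l + 1)
    have hp : (0 : ℝ) < (1 / 2) ^ (l + 1) := by positivity
    have h3 : (1 / 2 : ℝ) ^ (l + 1) = (1 / 2) ^ l / 2 := by ring
    have hterm (y : CantorSpace) :
        Real.ofDigitsTerm y l = ((y l : ℕ) : ℝ) * (1 / 2) ^ (l + 1) := by
      simp [Real.ofDigitsTerm]
    have hle (y : CantorSpace) : ((y l : ℕ) : ℝ) ≤ 1 := by
      have := (y l).isLt
      exact_mod_cast (by omega : (y l : ℕ) ≤ 1)
    rw [Finset.sum_range_succ] at hd ⊢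
    constructor
    · intro h
      have hl := hsum fun i hi => h i (by omega)
      rw [hl, show Real.ofDigitsTerm x l = Real.ofDigitsTerm (Real.digits r 2) l by
        simp [Real.ofDigitsTerm, h l (by omega)]]
      exact hd
    · rintro ⟨ha, hb⟩
      have hxl := hterm x
      have hx0 := Real.ofDigitsTerm_nonneg (digits := x) (n := l)
      have hx1 := mul_le_mul_of_nonneg_right (hle x) hp.le
      have hprev := ih.mpr ⟨by linarith, by linarith⟩
      have hl := hsum hprev
      have hdl := hterm (Real.digits r 2)
      have hlt : |((Real.digits r 2 l : ℕ) : ℝ) - ((x l : ℕ) : ℝ)| < 1 := by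
        rw [abs_lt]
        constructor <;> nlinarith [hd.1, hd.2]
      have heq : Real.digits r 2 l = x l := by
        have : |((Real.digits r 2 l : ℕ) : ℤ) - ((x l : ℕ) : ℤ)| < 1 := by exact_mod_cast hlt
        rw [Int.abs_lt_one_iff] at this
        apply Fin.ext
        omega
      intro i hi
      rcases Nat.lt_succ_iff_lt_or_eq.mp hi with h | rfl
      · exact hprev i h
      · exact heq

/-- The binary expansion of a point of the torus (the one without a tail of ones). -/
def expansion (y : Torus) : CantorSpace := Real.digits ((AddCircle.equivIco 1 0 y : ℝ)) 2

lemma expansion_mem_cyl {l : ℕ} (w : Word l) (y : Torus) :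
    expansion y ∈ cyl w ↔ y ∈ dyadic w := by
  obtain ⟨x, rfl⟩ := exists_extension w
  have hr : ((AddCircle.equivIco (1 : ℝ) 0 y : ℝ)) ∈ Set.Ico (0 : ℝ) 1 := by
    simpa using (AddCircle.equivIco (1 : ℝ) 0 y).2
  have h1 : expansion y ∈ cyl (fun i : Fin l => x i) ↔
      ∀ i < l, Real.digits ((AddCircle.equivIco (1 : ℝ) 0 y : ℝ)) 2 i = x i :=
    ⟨fun h i hi => h ⟨i, hi⟩, fun h i => h i i.2⟩
  rw [h1, digits_eq_iff hr, ← wordVal_restrict]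
  constructor
  · intro h
    exact ⟨_, h, (AddCircle.equivIco (1 : ℝ) 0).symm_apply_apply y⟩
  · rintro ⟨r, hrI, rfl⟩
    have hr' : r ∈ Set.Ico (0 : ℝ) (0 + 1) :=
      ⟨(wordVal_nonneg _).trans hrI.1, by
        rw [zero_add]; exact hrI.2.trans_le (wordVal_add_le_one _)⟩
    rwa [AddCircle.equivIco_coe_eq hr']

lemma measurable_expansion : Measurable expansion := by
  refine measurable_pi_lambda _ fun i => ?_
  have h : Measurable fun y : Torus => ((AddCircle.equivIco (1 : ℝ) 0 y : ℝ)) :=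
    measurable_subtype_coe.comp (AddCircle.measurableEquivIco (1 : ℝ) 0).measurable
  exact (measurable_of_countable (Fin.ofNat 2)).comp
    (Nat.measurable_floor.comp (h.mul_const _))

lemma measurableSet_cyl {l : ℕ} (w : Word l) : MeasurableSet (cyl w) := by
  have h : cyl w = ⋂ i : Fin l, (fun y : CantorSpace => y (i : ℕ)) ⁻¹' {w i} := by
    ext y
    simp [cyl]
  rw [h]
  exact MeasurableSet.iInter fun i =>
    (measurable_pi_apply (i : ℕ)) (measurableSet_singleton (w i))

lemma isPiSystem_cyl : IsPiSystem {s : Set CantorSpace | ∃ (l : ℕ) (w : Word l), s = cyl w} := by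
  rintro _ ⟨l, w, rfl⟩ _ ⟨m, u, rfl⟩ ⟨x, hx, hx'⟩
  refine ⟨max l m, fun i => x i, Set.ext fun y => ⟨fun ⟨h, h'⟩ i => ?_, fun h => ⟨fun i => ?_, fun i => ?_⟩⟩⟩
  · rcases lt_max_iff.mp i.2 with hi | hi
    · exact (h ⟨i, hi⟩).trans (hx ⟨i, hi⟩).symm
    · exact (h' ⟨i, hi⟩).trans (hx' ⟨i, hi⟩).symm
  · exact (h ⟨i, i.2.trans_le (le_max_left _ _)⟩).trans (hx i)
  · exact (h ⟨i, i.2.trans_le (le_max_right _ _)⟩).trans (hx' i)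

lemma generateFrom_cyl : (MeasurableSpace.pi : MeasurableSpace CantorSpace) =
    MeasurableSpace.generateFrom {s | ∃ (l : ℕ) (w : Word l), s = cyl w} := by
  apply le_antisymm
  · refine iSup_le fun i => ?_
    rintro _ ⟨s, -, rfl⟩
    have : (fun y : CantorSpace => y i) ⁻¹' s = ⋃ w ∈ {w : Word (i + 1) | w (Fin.last i) ∈ s}, cyl w := by
      ext y
      simp only [Set.mem_preimage, Set.mem_ofPred_eq, Set.mem_iUnion, exists_prop]
      constructor
      · intro h
        exact ⟨fun j => y j, h, fun _ => rfl⟩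
      · rintro ⟨w, hw, hy⟩
        have := hy (Fin.last i)
        rw [Fin.val_last] at this
        rwa [this]
    rw [this]
    exact MeasurableSet.biUnion (Set.to_countable _) fun w _ =>
      MeasurableSpace.measurableSet_generateFrom ⟨_, w, rfl⟩
  · refine MeasurableSpace.generateFrom_le ?_
    rintro _ ⟨l, w, rfl⟩
    exact measurableSet_cyl w

theorem existsUnique_lift (μ : ProbabilityMeasure Torus) :
    ∃! ν : ProbabilityMeasure CantorSpace,
      ∀ (l : ℕ) (w : Word l),
        (ν : Measure CantorSpace) (cyl w) = (μ : Measure Torus) (dyadic w) := by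
  have key (l : ℕ) (w : Word l) : ((μ.map measurable_expansion.aemeasurable :
      ProbabilityMeasure CantorSpace) : Measure CantorSpace) (cyl w) =
        (μ : Measure Torus) (dyadic w) := by
    rw [ProbabilityMeasure.toMeasure_map,
      Measure.map_apply measurable_expansion (measurableSet_cyl w)]
    congr 1
    exact Set.ext fun y => expansion_mem_cyl w y
  refine ⟨μ.map measurable_expansion.aemeasurable, key, fun ν hν => ?_⟩
  have hp : IsProbabilityMeasure ν.1 := ν.2
  apply Subtype.ext
  refine ext_of_generate_finite _ generateFrom_cyl isPiSystem_cyl ?_ ?_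
  · rintro _ ⟨l, w, rfl⟩
    exact (hν l w).trans (key l w).symm
  · exact ν.2.measure_univ.trans (Subtype.prop (μ.map
      measurable_expansion.aemeasurable)).measure_univ.symm

/-- The lift of `μ`: the unique measure on Cantor space that gives each cylinder `cyl w` the
`μ`-measure of the dyadic interval of `w`. -/
def lift (μ : ProbabilityMeasure Torus) : ProbabilityMeasure CantorSpace :=
  (existsUnique_lift μ).choose

theorem lift_cyl (μ : ProbabilityMeasure Torus) {l : ℕ} (w : Word l) :
    (lift μ : Measure CantorSpace) (cyl w) = (μ : Measure Torus) (dyadic w) :=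
  (existsUnique_lift μ).choose_spec.1 l w

/-! ### Finite-state dimensions -/

/-- The prefix of length `n` of an infinite sequence. -/
def pref (x : CantorSpace) (n : ℕ) : Word n := fun i => x i

open Classical in
/-- The number of positions at which `w` occurs in `u` (overlaps allowed). -/
def slidingCount {n l : ℕ} (u : Word n) (w : Word l) : ℕ :=
  ((Finset.range (n + 1)).filter fun i =>
    ∃ h : i + l ≤ n, ∀ j : Fin l, u ⟨i + j, by omega⟩ = w j).card

/-- The sliding count probability of `w` in `u`. -/
def slidingProb {n l : ℕ} (u : Word n) (w : Word l) : ℝ :=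
  (slidingCount u w : ℝ) / ((n : ℝ) - (l : ℝ) + 1)

/-- The sliding block entropy of `u` for block length `l`, normalized by `l`. -/
def blockEntropy {n : ℕ} (l : ℕ) (u : Word n) : ℝ :=
  -(1 / (l : ℝ)) * ∑ w : Word l, slidingProb u w * Real.logb 2 (slidingProb u w)

/-- The finite-state dimension; the infimum is over block lengths `l ≥ 1`. -/
def finiteStateDim (x : CantorSpace) : ℝ :=
  ⨅ l : ℕ+, liminf (fun n : ℕ => blockEntropy (l : ℕ) (pref x n)) atTop

/-- The finite-state strong dimension; the infimum is over block lengths `l ≥ 1`. -/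
def finiteStateStrongDim (x : CantorSpace) : ℝ :=
  ⨅ l : ℕ+, limsup (fun n : ℕ => blockEntropy (l : ℕ) (pref x n)) atTop

/-! ### Average entropies of measures on Cantor space -/

/-- The entropy of the distribution of the first `n` symbols under `ν`. -/
def entropy (ν : ProbabilityMeasure CantorSpace) (n : ℕ) : ℝ :=
  -∑ w : Word n, (ν : Measure CantorSpace).real (cyl w) *
    Real.logb 2 ((ν : Measure CantorSpace).real (cyl w))

/-- The upper average entropy. -/
def upperEntropy (ν : ProbabilityMeasure CantorSpace) : ℝ :=
  limsup (fun n : ℕ => entropy ν n / (n : ℝ)) atTop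

/-- The lower average entropy. -/
def lowerEntropy (ν : ProbabilityMeasure CantorSpace) : ℝ :=
  liminf (fun n : ℕ => entropy ν n / (n : ℝ)) atTop

/-! ### Weyl averages -/

/-- The character `y ↦ exp (2 π i k y)` of the torus is `fourier k`; this is the `n`-th Weyl
average `(1 / n) ∑_{j < n} exp (2 π i k v(T^j x))`. -/
def weylAverage (x : CantorSpace) (k : ℤ) (n : ℕ) : ℂ :=
  (1 / (n : ℂ)) * ∑ j ∈ Finset.range n, fourier k (val (shift^[j] x))

/-- The `k`-th Fourier coefficient `∫ exp (2 π i k y) dμ` of a measure on the torus. -/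
def fourierCoefficient (μ : ProbabilityMeasure Torus) (k : ℤ) : ℂ :=
  ∫ y : Torus, fourier k y ∂(μ : Measure Torus)

/-- The measures on the torus whose Fourier coefficients are the limits, for all `k` at once, of
the Weyl averages of `x` along some strictly increasing sequence of natural numbers. -/
def weylLimits (x : CantorSpace) : Set (ProbabilityMeasure Torus) :=
  {μ | ∃ n : ℕ → ℕ, StrictMono n ∧
    ∀ k : ℤ, Tendsto (fun m : ℕ => weylAverage x k (n m)) atTop (𝓝 (fourierCoefficient μ k))}

/-- The lifts to Cantor space of all measures in `weylLimits x`. -/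
def liftedWeylLimits (x : CantorSpace) : Set (ProbabilityMeasure CantorSpace) :=
  lift '' weylLimits x

end WeylFSD

end

noncomputable section

namespace WeylFSD

/-! ### Cluster points and limits inferior and superior -/

section ClusterPoints

variable {K : Type*} [TopologicalSpace K] [CompactSpace K] {u : ℕ → K} {F : K → ℝ}

/-! Everything is read off the empirical measures of the orbit of `x`, a sequence in the compact
space of probability measures on Cantor space. The sliding frequency of `w` is the empirical measure
of `cyl w`, so block entropies are entropies of empirical measures (`blockEntropy_pref`), and these
are continuous because cylinders are clopen. The Weyl averages are the Fourier coefficients of the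
images under `val`. As Fourier coefficients determine a measure on the torus, the Weyl limits are
exactly the images of the cluster points (`weylLimits_eq`).

Cluster points `ν` are shift-invariant. Hence their entropy is subadditive, and `entropy ν n / n`
converges to its infimum `entropyRate ν` (Fekete). Passing to the torus and lifting back changes `ν`
on at most two cylinders of each length (`lift_toTorus_cyl`), so both average entropies of the lift
equal `entropyRate ν`.

It remains to compare an infimum over block lengths with extrema over cluster points. For the
dimension two infima are exchanged (`isGLB_entropyRate`). For the strong dimension an infimum is
exchanged with a supremum, which takes compactness and monotonicity along block lengths `2 ^ k`
(`isLUB_entropyRate`). -/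

lemma bddAbove_range_of_compact (hF : Continuous F) : BddAbove (Set.range F) :=
  (isCompact_range hF).bddAbove

lemma bddBelow_range_of_compact (hF : Continuous F) : BddBelow (Set.range F) :=
  (isCompact_range hF).bddBelow

lemma isBoundedUnder_le_comp (hF : Continuous F) :
    IsBoundedUnder (· ≤ ·) atTop fun n => F (u n) := by
  obtain ⟨b, hb⟩ := bddAbove_range_of_compact hF
  exact isBoundedUnder_of ⟨b, fun n => hb ⟨u n, rfl⟩⟩

lemma isBoundedUnder_ge_comp (hF : Continuous F) :
    IsBoundedUnder (· ≥ ·) atTop fun n => F (u n) := by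
  obtain ⟨b, hb⟩ := bddBelow_range_of_compact hF
  exact isBoundedUnder_of ⟨b, fun n => hb ⟨u n, rfl⟩⟩

lemma liminf_le_of_mapClusterPt (hF : Continuous F) {a : K} (ha : MapClusterPt a atTop u) :
    liminf (fun n => F (u n)) atTop ≤ F a := by
  refine le_of_forall_gt_imp_ge_of_dense fun c hc => ?_
  refine liminf_le_of_frequently_le ?_ (isBoundedUnder_ge_comp hF)
  exact (ha.frequently (hF.continuousAt.eventually (gt_mem_nhds hc))).mono fun n hn => le_of_lt hn

lemma le_limsup_of_mapClusterPt (hF : Continuous F) {a : K} (ha : MapClusterPt a atTop u) :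
    F a ≤ limsup (fun n => F (u n)) atTop := by
  refine le_of_forall_lt_imp_le_of_dense fun c hc => ?_
  refine le_limsup_of_frequently_le ?_ (isBoundedUnder_le_comp hF)
  exact (ha.frequently (hF.continuousAt.eventually (lt_mem_nhds hc))).mono fun n hn => le_of_lt hn

/-- The sequence visits the sublevel set infinitely often, and that set is closed, hence compact. -/
lemma exists_mapClusterPt_le (hF : Continuous F) {c : ℝ}
    (hc : liminf (fun n => F (u n)) atTop < c) : ∃ a, F a ≤ c ∧ MapClusterPt a atTop u := by
  have hs : IsCompact {a | F a ≤ c} := (isClosed_le hF continuous_const).isCompact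
  refine hs.exists_mapClusterPt_of_frequently ?_
  exact (frequently_lt_of_liminf_lt (isBoundedUnder_le_comp hF).isCoboundedUnder_ge hc).mono
    fun n hn => le_of_lt hn

lemma exists_mapClusterPt_ge (hF : Continuous F) {c : ℝ}
    (hc : c < limsup (fun n => F (u n)) atTop) : ∃ a, c ≤ F a ∧ MapClusterPt a atTop u := by
  have hs : IsCompact {a | c ≤ F a} := (isClosed_le continuous_const hF).isCompact
  refine hs.exists_mapClusterPt_of_frequently ?_
  exact (frequently_lt_of_lt_limsup (isBoundedUnder_ge_comp hF).isCoboundedUnder_le hc).mono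
    fun n hn => le_of_lt hn

end ClusterPoints

lemma eq_of_mapClusterPt_of_tendsto {α K Y : Type*} [TopologicalSpace K] [TopologicalSpace Y]
    [T2Space Y] {l : Filter α} {u : α → K} {a : K} (ha : MapClusterPt a l u) {g : K → Y}
    (hg : ContinuousAt g a) {c : Y} (hc : Tendsto (fun n => g (u n)) l (𝓝 c)) : g a = c := by
  have h : ClusterPt (g a) (map (g ∘ u) l) := ha.continuousAt_comp hg
  have h2 : ClusterPt (g a) (𝓝 c) := h.mono hc
  exact eq_of_nhds_neBot h2

/-! ### Cylinders and the shift -/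

lemma shift_iterate (x : CantorSpace) (j i : ℕ) : shift^[j] x i = x (i + j) := by
  induction j generalizing i with
  | zero => rfl
  | succ j ih =>
    rw [Function.iterate_succ_apply', shift, ih]
    congr 1
    omega

lemma continuous_shift : Continuous shift :=
  continuous_pi fun i => continuous_apply (i + 1)

lemma isClopen_cyl {l : ℕ} (w : Word l) : IsClopen (cyl w) := by
  have h : cyl w = ⋂ i : Fin l, (fun y : CantorSpace => y (i : ℕ)) ⁻¹' {w i} := by
    ext y
    simp [cyl]
  rw [h]
  exact isClopen_iInter_of_finite fun i => (isClopen_discrete {w i}).preimage (continuous_apply _)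

lemma continuous_measureReal_of_isClopen {s : Set CantorSpace} (hs : IsClopen s) :
    Continuous fun ν : ProbabilityMeasure CantorSpace => (ν : Measure CantorSpace).real s := by
  rw [continuous_iff_continuousAt]
  intro ν
  have h := ProbabilityMeasure.tendsto_measure_of_isClopen_of_tendsto (tendsto_id (x := 𝓝 ν)) hs
  exact (NNReal.continuous_coe.tendsto _).comp h

lemma entropy_eq_sum_negMulLog (ν : ProbabilityMeasure CantorSpace) (n : ℕ) :
    entropy ν n =
      (∑ w : Word n, Real.negMulLog ((ν : Measure CantorSpace).real (cyl w))) / Real.log 2 := by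
  rw [entropy, ← Finset.sum_neg_distrib, Finset.sum_div]
  refine Finset.sum_congr rfl fun w _ => ?_
  rw [Real.logb, Real.negMulLog]
  ring

lemma entropy_nonneg (ν : ProbabilityMeasure CantorSpace) (n : ℕ) : 0 ≤ entropy ν n := by
  rw [entropy_eq_sum_negMulLog]
  exact div_nonneg (Finset.sum_nonneg fun w _ =>
    Real.negMulLog_nonneg measureReal_nonneg measureReal_le_one) (Real.log_nonneg (by norm_num))

lemma continuous_entropy (n : ℕ) : Continuous fun ν => entropy ν n := by
  simp_rw [entropy_eq_sum_negMulLog]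
  exact (continuous_finsetSum _ fun w _ => Real.continuous_negMulLog.comp
    (continuous_measureReal_of_isClopen (isClopen_cyl w))).div_const _

/-! ### Empirical measures -/

/-- The uniform measure on the first `max n 1` points of the orbit of `x` under the shift. -/
def empirical (x : CantorSpace) (n : ℕ) : ProbabilityMeasure CantorSpace :=
  ⟨((max n 1 : ℕ) : ENNReal)⁻¹ • ∑ j ∈ Finset.range (max n 1), Measure.dirac (shift^[j] x), ⟨by
    have h : ((max n 1 : ℕ) : ENNReal) ≠ 0 := by
      rw [Nat.cast_ne_zero]; omega
    simp [Measure.smul_apply, Measure.finsetSum_apply, -Nat.cast_max,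
      ENNReal.inv_mul_cancel h (ENNReal.natCast_ne_top _)]⟩⟩

lemma empirical_toMeasure (x : CantorSpace) {n : ℕ} (hn : n ≠ 0) :
    (empirical x n : Measure CantorSpace) =
      (n : ENNReal)⁻¹ • ∑ j ∈ Finset.range n, Measure.dirac (shift^[j] x) := by
  have h : max n 1 = n := by omega
  change ((max n 1 : ℕ) : ENNReal)⁻¹ • _ = _
  rw [h]

lemma integral_empirical {G : Type*} [NormedAddCommGroup G] [NormedSpace ℝ G] [CompleteSpace G]
    (x : CantorSpace) {n : ℕ} (hn : n ≠ 0) {f : CantorSpace → G} (hf : StronglyMeasurable f) :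
    ∫ y, f y ∂(empirical x n : Measure CantorSpace) =
      (n : ℝ)⁻¹ • ∑ j ∈ Finset.range n, f (shift^[j] x) := by
  rw [empirical_toMeasure x hn, integral_smul_measure, integral_finsetSum_measure]
  · simp [integral_dirac' _ _ hf]
  · intro i _
    exact integrable_dirac' hf (by simp)

lemma empirical_real (x : CantorSpace) {n : ℕ} (hn : n ≠ 0) {s : Set CantorSpace}
    (hs : MeasurableSet s) :
    (empirical x n : Measure CantorSpace).real s =
      (n : ℝ)⁻¹ * ∑ j ∈ Finset.range n, s.indicator 1 (shift^[j] x) := by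
  rw [← integral_indicator_one hs,
    integral_empirical x hn (stronglyMeasurable_one.indicator hs), smul_eq_mul]

/-- The two orbit sums telescope: they differ only in their end terms, so the difference is at most
`1 / n`. -/
lemma tendsto_empirical_shift (x : CantorSpace) {s : Set CantorSpace} (hs : MeasurableSet s) :
    Tendsto (fun n => (empirical x n : Measure CantorSpace).real (shift ⁻¹' s) -
      (empirical x n : Measure CantorSpace).real s) atTop (𝓝 0) := by
  have hbound : ∀ n : ℕ, n ≠ 0 → |(empirical x n : Measure CantorSpace).real (shift ⁻¹' s) -
      (empirical x n : Measure CantorSpace).real s| ≤ (n : ℝ)⁻¹ := by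
    intro n hn
    rw [empirical_real x hn (continuous_shift.measurable hs), empirical_real x hn hs, ← mul_sub,
      ← Finset.sum_sub_distrib, abs_mul, abs_of_nonneg (by positivity)]
    refine mul_le_of_le_one_right (by positivity) ?_
    have h : ∀ j, (shift ⁻¹' s).indicator (1 : CantorSpace → ℝ) (shift^[j] x) =
        s.indicator 1 (shift^[j + 1] x) := by
      intro j
      rw [Function.iterate_succ_apply']
      rfl
    simp_rw [h]
    rw [Finset.sum_range_sub (fun j => s.indicator (1 : CantorSpace → ℝ) (shift^[j] x))]
    have h0 : ∀ y, 0 ≤ s.indicator (1 : CantorSpace → ℝ) y :=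
      Set.indicator_nonneg fun _ _ => zero_le_one
    have h1 : ∀ y, s.indicator (1 : CantorSpace → ℝ) y ≤ 1 :=
      Set.indicator_le_self' (fun _ _ => zero_le_one)
    rw [abs_le]
    constructor <;> linarith [h0 (shift^[n] x), h0 (shift^[0] x), h1 (shift^[n] x),
      h1 (shift^[0] x)]
  refine squeeze_zero_norm' ?_ tendsto_inv_atTop_nhds_zero_nat
  filter_upwards [eventually_ne_atTop 0] with n hn
  exact hbound n hn

lemma measurePreserving_shift_of_mapClusterPt {x : CantorSpace} {ν : ProbabilityMeasure CantorSpace}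
    (hν : MapClusterPt ν atTop (empirical x)) :
    MeasurePreserving shift (ν : Measure CantorSpace) (ν : Measure CantorSpace) := by
  refine ⟨continuous_shift.measurable, ?_⟩
  have : IsProbabilityMeasure (Measure.map shift (ν : Measure CantorSpace)) :=
    Measure.isProbabilityMeasure_map continuous_shift.measurable.aemeasurable
  refine ext_of_generate_finite _ generateFrom_cyl isPiSystem_cyl ?_ (by simp)
  rintro _ ⟨l, w, rfl⟩
  rw [Measure.map_apply continuous_shift.measurable (measurableSet_cyl w)]
  have h := eq_of_mapClusterPt_of_tendsto hν
    ((continuous_measureReal_of_isClopen ((isClopen_cyl w).preimage continuous_shift)).sub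
      (continuous_measureReal_of_isClopen (isClopen_cyl w))).continuousAt
    (tendsto_empirical_shift x (measurableSet_cyl w))
  exact (measureReal_eq_measureReal_iff).1 (sub_eq_zero.1 h)

/-! ### Sliding block entropies are entropies of empirical measures -/

lemma slidingCount_pref (x : CantorSpace) {n l : ℕ} (hl : l ≤ n) (w : Word l) :
    (slidingCount (pref x n) w : ℝ) =
      ∑ j ∈ Finset.range (n + 1 - l), (cyl w).indicator (1 : CantorSpace → ℝ) (shift^[j] x) := by
  classical
  have h : ((Finset.range (n + 1)).filter fun i =>
      ∃ h : i + l ≤ n, ∀ j : Fin l, pref x n ⟨i + j, by omega⟩ = w j) =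
      (Finset.range (n + 1 - l)).filter fun i => shift^[i] x ∈ cyl w := by
    ext i
    rw [Finset.mem_filter, Finset.mem_filter, Finset.mem_range, Finset.mem_range]
    simp only [cyl, Set.mem_ofPred_eq, shift_iterate, pref]
    constructor
    · rintro ⟨-, h1, h2⟩
      exact ⟨by omega, fun j => by rw [add_comm]; exact h2 j⟩
    · rintro ⟨h1, h2⟩
      exact ⟨by omega, by omega, fun j => by rw [add_comm i]; exact h2 j⟩
  rw [slidingCount]
  convert congrArg (fun s : Finset ℕ => (s.card : ℝ)) h using 1
  simp [Set.indicator_apply, Finset.sum_boole]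

lemma slidingProb_pref (x : CantorSpace) {n l : ℕ} (hl : l ≤ n) (w : Word l) :
    slidingProb (pref x n) w = (empirical x (n + 1 - l) : Measure CantorSpace).real (cyl w) := by
  rw [slidingProb, slidingCount_pref x hl, empirical_real x (by omega) (measurableSet_cyl w),
    Nat.cast_sub (by omega), div_eq_inv_mul]
  push_cast
  ring_nf

lemma blockEntropy_pref (x : CantorSpace) {n l : ℕ} (hl : l ≤ n) :
    blockEntropy l (pref x n) = entropy (empirical x (n + 1 - l)) l / l := by
  simp_rw [blockEntropy, slidingProb_pref x hl, entropy]
  ring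

lemma liminf_blockEntropy (x : CantorSpace) (l : ℕ) :
    liminf (fun n => blockEntropy l (pref x n)) atTop =
      liminf (fun n => entropy (empirical x n) l / l) atTop := by
  -- A prefix of length `n + l` has `n + 1` windows of length `l`, hence the shifts by `l` and by
  -- `1`.
  rw [← liminf_nat_add _ l, ← liminf_nat_add (fun n => entropy (empirical x n) l / l) 1]
  congr 1 with n
  rw [blockEntropy_pref x (by omega), show n + l + 1 - l = n + 1 by omega]

lemma limsup_blockEntropy (x : CantorSpace) (l : ℕ) :
    limsup (fun n => blockEntropy l (pref x n)) atTop =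
      limsup (fun n => entropy (empirical x n) l / l) atTop := by
  rw [← limsup_nat_add _ l, ← limsup_nat_add (fun n => entropy (empirical x n) l / l) 1]
  congr 1 with n
  rw [blockEntropy_pref x (by omega), show n + l + 1 - l = n + 1 by omega]

/-! ### Weyl limits are the images of the cluster points of the empirical measures -/

lemma continuous_val : Continuous val :=
  (AddCircle.continuous_mk' 1).comp Real.continuous_ofDigits

lemma weylAverage_eq_integral (x : CantorSpace) (k : ℤ) {n : ℕ} (hn : n ≠ 0) :
    weylAverage x k n =
      fourierCoefficient ((empirical x n).map continuous_val.measurable.aemeasurable) k := by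
  have hf : Continuous fun y : CantorSpace => (fourier k (val y) : ℂ) :=
    (fourier k).continuous.comp continuous_val
  rw [fourierCoefficient, ProbabilityMeasure.toMeasure_map,
    integral_map continuous_val.measurable.aemeasurable
      (fourier k).continuous.aestronglyMeasurable,
    integral_empirical x hn hf.stronglyMeasurable, weylAverage, Complex.real_smul]
  simp

lemma continuous_fourierCoefficient (k : ℤ) : Continuous fun μ => fourierCoefficient μ k := by
  rw [continuous_iff_continuousAt]
  intro μ
  exact (ProbabilityMeasure.tendsto_iff_forall_integral_rclike_tendsto ℂ).1 tendsto_id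
    (BoundedContinuousFunction.mkOfCompact (fourier k))

/-- Trigonometric polynomials are dense in the continuous functions, and integration against a
probability measure is 1-Lipschitz for the sup norm. -/
lemma ext_of_fourierCoefficient {μ μ' : ProbabilityMeasure Torus}
    (h : ∀ k, fourierCoefficient μ k = fourierCoefficient μ' k) : μ = μ' := by
  have hint (ρ : ProbabilityMeasure Torus) (f : C(Torus, ℂ)) :
      Integrable f (ρ : Measure Torus) :=
    (BoundedContinuousFunction.mkOfCompact f).integrable _
  have hcont (ρ : ProbabilityMeasure Torus) :
      Continuous fun f : C(Torus, ℂ) => ∫ y, f y ∂(ρ : Measure Torus) := by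
    refine LipschitzWith.continuous (K := 1) (LipschitzWith.of_dist_le_mul fun f g => ?_)
    rw [dist_eq_norm, dist_eq_norm, ← integral_sub (hint ρ f) (hint ρ g)]
    have h := norm_integral_le_of_norm_le_const (μ := (ρ : Measure Torus))
      (Eventually.of_forall fun y => (f - g).norm_coe_le_norm y)
    simpa using h
  have key (f : C(Torus, ℂ)) :
      ∫ y, f y ∂(μ : Measure Torus) = ∫ y, f y ∂(μ' : Measure Torus) := by
    let S : Submodule ℂ C(Torus, ℂ) :=
      { carrier := {f | ∫ y, f y ∂(μ : Measure Torus) = ∫ y, f y ∂(μ' : Measure Torus)}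
        add_mem' := fun {f g} hf hg => by
          simp only [Set.mem_ofPred_eq, ContinuousMap.add_apply] at hf hg ⊢
          rw [integral_add (hint μ f) (hint μ g), integral_add (hint μ' f) (hint μ' g), hf, hg]
        zero_mem' := by simp
        smul_mem' := fun c f hf => by
          simp only [Set.mem_ofPred_eq, ContinuousMap.smul_apply] at hf ⊢
          rw [integral_smul, integral_smul, hf] }
    have hS : IsClosed (S : Set C(Torus, ℂ)) := isClosed_eq (hcont μ) (hcont μ')
    have hle : (Submodule.span ℂ (Set.range (@fourier 1))).topologicalClosure ≤ S :=
      Submodule.topologicalClosure_minimal _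
        (Submodule.span_le.2 (Set.range_subset_iff.2 fun k => h k)) hS
    rw [span_fourier_closure_eq_top] at hle
    exact hle (Submodule.mem_top (x := f))
  have hμ : IsProbabilityMeasure μ.1 := μ.2
  have hμ' : IsProbabilityMeasure μ'.1 := μ'.2
  apply Subtype.ext
  refine ext_of_forall_integral_eq_of_IsFiniteMeasure fun f => ?_
  have hf := key ⟨fun y => (f y : ℂ), Complex.continuous_ofReal.comp f.continuous⟩
  simp only [ContinuousMap.coe_mk] at hf
  rw [integral_complex_ofReal, integral_complex_ofReal] at hf
  exact_mod_cast hf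

/-- The image on the torus of a measure on Cantor space. -/
def toTorus (ν : ProbabilityMeasure CantorSpace) : ProbabilityMeasure Torus :=
  ν.map continuous_val.measurable.aemeasurable

lemma continuous_toTorus : Continuous toTorus :=
  ProbabilityMeasure.continuous_map continuous_val

lemma eventually_weylAverage_eq (x : CantorSpace) {n : ℕ → ℕ} (hn : StrictMono n) (k : ℤ) :
    (fun m => weylAverage x k (n m)) =ᶠ[atTop]
      fun m => fourierCoefficient (toTorus (empirical x (n m))) k := by
  filter_upwards [hn.tendsto_atTop.eventually (eventually_ne_atTop 0)] with m hm
  exact weylAverage_eq_integral x k hm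

/-- Compactness supplies the measure, so no positive-definiteness argument for `c` is needed. -/
lemma exists_mapClusterPt_of_tendsto {x : CantorSpace} {n : ℕ → ℕ} {c : ℤ → ℂ}
    (hn : StrictMono n) (hc : ∀ k : ℤ, Tendsto (fun m => weylAverage x k (n m)) atTop (𝓝 (c k))) :
    ∃ ν, MapClusterPt ν atTop (empirical x) ∧ ∀ k, fourierCoefficient (toTorus ν) k = c k := by
  obtain ⟨ν, -, hν⟩ := isCompact_univ.exists_mapClusterPt
    (f := atTop) (u := fun m => empirical x (n m)) (by simp)
  refine ⟨ν, MapClusterPt.of_comp hn.tendsto_atTop hν, fun k => ?_⟩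
  exact eq_of_mapClusterPt_of_tendsto hν
    ((continuous_fourierCoefficient k).comp continuous_toTorus).continuousAt
    ((hc k).congr' (eventually_weylAverage_eq x hn k))

lemma weylLimits_eq (x : CantorSpace) :
    weylLimits x = toTorus '' {ν | MapClusterPt ν atTop (empirical x)} := by
  ext μ
  constructor
  · rintro ⟨n, hn, hμ⟩
    obtain ⟨ν, hν, h⟩ := exists_mapClusterPt_of_tendsto hn hμ
    exact ⟨ν, hν, ext_of_fourierCoefficient h⟩
  · rintro ⟨ν, hν, rfl⟩
    -- The subsequence is extracted in the countable product `ℤ → ℂ`, which is first countable. This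
    -- gives one subsequence for all `k` and avoids metrizing the space of measures.
    have hF : Continuous fun ν' => fun k : ℤ => fourierCoefficient (toTorus ν') k :=
      continuous_pi fun k => (continuous_fourierCoefficient k).comp continuous_toTorus
    obtain ⟨n, hn, h⟩ := (MapClusterPt.continuousAt_comp hF.continuousAt hν).tendsto_subseq
    refine ⟨n, hn, fun k => ?_⟩
    exact ((tendsto_pi_nhds.1 h) k).congr' (eventually_weylAverage_eq x hn k).symm

/-! ### Subadditivity of the entropy of shift-invariant measures -/

/-- Nonnegativity of mutual information, from `log t ≤ t - 1` at `t = p a * q b / r a b`. The error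
terms `p a * q b - r a b` in `key` sum to zero. -/
lemma sum_negMulLog_le_marginals {A B : Type*} [Fintype A] [Fintype B] (r : A → B → ℝ)
    (hr : ∀ a b, 0 ≤ r a b) (h1 : ∑ a, ∑ b, r a b = 1) :
    ∑ a, ∑ b, Real.negMulLog (r a b) ≤
      ∑ a, Real.negMulLog (∑ b, r a b) + ∑ b, Real.negMulLog (∑ a, r a b) := by
  set p : A → ℝ := fun a => ∑ b, r a b with hp
  set q : B → ℝ := fun b => ∑ a, r a b with hq
  have hp0 (a : A) : 0 ≤ p a := Finset.sum_nonneg fun b _ => hr a b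
  have hq0 (b : B) : 0 ≤ q b := Finset.sum_nonneg fun a _ => hr a b
  have hq1 : ∑ b, q b = 1 := by rw [← h1, hq, Finset.sum_comm]
  have key (a : A) (b : B) : Real.negMulLog (r a b) ≤
      -(r a b * Real.log (p a)) + -(r a b * Real.log (q b)) + (p a * q b - r a b) := by
    rcases (hr a b).eq_or_lt with h | h
    · rw [← h]
      simpa using mul_nonneg (hp0 a) (hq0 b)
    · have hpa : 0 < p a :=
        h.trans_le (Finset.single_le_sum (f := fun b => r a b) (fun b _ => hr a b)
          (Finset.mem_univ b))
      have hqb : 0 < q b :=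
        h.trans_le (Finset.single_le_sum (f := fun a => r a b) (fun a _ => hr a b)
          (Finset.mem_univ a))
      have hlog := Real.log_le_sub_one_of_pos (div_pos (mul_pos hpa hqb) h)
      rw [Real.log_div (mul_pos hpa hqb).ne' h.ne', Real.log_mul hpa.ne' hqb.ne'] at hlog
      have hmul := mul_le_mul_of_nonneg_left hlog h.le
      rw [mul_sub, mul_sub, mul_div_cancel₀ _ h.ne'] at hmul
      rw [Real.negMulLog]
      linarith
  have e1 : ∑ a, ∑ b, -(r a b * Real.log (p a)) = ∑ a, Real.negMulLog (p a) := by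
    refine Finset.sum_congr rfl fun a _ => ?_
    rw [Finset.sum_neg_distrib, ← Finset.sum_mul, Real.negMulLog, neg_mul]
  have e2 : ∑ a, ∑ b, -(r a b * Real.log (q b)) = ∑ b, Real.negMulLog (q b) := by
    rw [Finset.sum_comm]
    refine Finset.sum_congr rfl fun b _ => ?_
    rw [Finset.sum_neg_distrib, ← Finset.sum_mul, Real.negMulLog, neg_mul]
  have e3 : ∑ a, ∑ b, (p a * q b - r a b) = 0 := by
    simp_rw [Finset.sum_sub_distrib, ← Finset.mul_sum, hq1, mul_one]
    exact sub_self _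
  calc ∑ a, ∑ b, Real.negMulLog (r a b)
      ≤ ∑ a, ∑ b, (-(r a b * Real.log (p a)) + -(r a b * Real.log (q b)) +
          (p a * q b - r a b)) := Finset.sum_le_sum fun a _ => Finset.sum_le_sum fun b _ => key a b
    _ = _ := by simp_rw [Finset.sum_add_distrib]; rw [e1, e2, e3, add_zero]

lemma sum_measureReal_inter_cyl (ν : ProbabilityMeasure CantorSpace) {f : CantorSpace → CantorSpace}
    (hf : Measurable f) {s : Set CantorSpace} (hs : MeasurableSet s) (n : ℕ) :
    ∑ w : Word n, (ν : Measure CantorSpace).real (s ∩ f ⁻¹' cyl w) =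
      (ν : Measure CantorSpace).real s := by
  rw [← measureReal_iUnion_fintype]
  · congr 1
    ext y
    simp only [Set.mem_iUnion, Set.mem_inter_iff, exists_and_left, and_iff_left_iff_imp]
    exact fun _ => ⟨fun i => f y i, fun _ => rfl⟩
  · intro w w' hw
    refine Set.disjoint_left.2 fun y h h' => hw (funext fun i => ?_)
    exact (h.2 i).symm.trans (h'.2 i)
  · exact fun w => hs.inter (hf (measurableSet_cyl w))

lemma cyl_append {m n : ℕ} (u : Word m) (v : Word n) :
    cyl (Fin.append u v) = cyl u ∩ shift^[m] ⁻¹' cyl v := by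
  ext y
  simp only [cyl, Set.mem_inter_iff, Set.mem_preimage, Set.mem_ofPred_eq, shift_iterate]
  constructor
  · intro h
    refine ⟨fun i => by simpa using h (Fin.castAdd n i), fun i => ?_⟩
    have := h (Fin.natAdd m i)
    rw [Fin.append_right, Fin.val_natAdd] at this
    rwa [add_comm]
  · rintro ⟨h, h'⟩ i
    refine Fin.addCases (fun i => ?_) (fun i => ?_) i
    · simpa using h i
    · rw [Fin.append_right, Fin.val_natAdd, add_comm]
      exact h' i

/-- A word of length `m + n` is a pair of words. Invariance makes the marginal of the second one the
distribution of the first `n` symbols. -/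
lemma subadditive_entropy {ν : ProbabilityMeasure CantorSpace}
    (hν : MeasurePreserving shift (ν : Measure CantorSpace) (ν : Measure CantorSpace)) :
    Subadditive (entropy ν) := by
  intro m n
  have hm := hν.iterate m
  have hmeas := hm.measurable
  have hsum := sum_negMulLog_le_marginals
    (fun (u : Word m) (v : Word n) =>
      (ν : Measure CantorSpace).real (cyl u ∩ shift^[m] ⁻¹' cyl v))
    (fun _ _ => measureReal_nonneg) (by
      simp_rw [sum_measureReal_inter_cyl ν hmeas (measurableSet_cyl _)]
      have := sum_measureReal_inter_cyl ν measurable_id MeasurableSet.univ m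
      simpa using this)
  have hright (v : Word n) : ∑ u : Word m,
      (ν : Measure CantorSpace).real (cyl u ∩ shift^[m] ⁻¹' cyl v) =
        (ν : Measure CantorSpace).real (cyl v) := by
    have := sum_measureReal_inter_cyl ν measurable_id (hmeas (measurableSet_cyl v)) m
    simp only [Set.preimage_id, Set.inter_comm (shift^[m] ⁻¹' cyl v)] at this
    rw [this, hm.measureReal_preimage (measurableSet_cyl v).nullMeasurableSet]
  simp_rw [hright, sum_measureReal_inter_cyl ν hmeas (measurableSet_cyl _)] at hsum
  simp_rw [entropy_eq_sum_negMulLog]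
  rw [← add_div]
  refine div_le_div_of_nonneg_right ?_ (Real.log_nonneg (by norm_num))
  rw [← (Fin.appendEquiv m n).sum_comp, Fintype.sum_prod_type]
  refine le_trans (le_of_eq ?_) hsum
  refine Finset.sum_congr rfl fun u _ => Finset.sum_congr rfl fun v _ => ?_
  rw [← cyl_append]
  rfl

lemma bddBelow_entropy_div (ν : ProbabilityMeasure CantorSpace) :
    BddBelow (Set.range fun n : ℕ => entropy ν n / n) :=
  ⟨0, by rintro _ ⟨n, rfl⟩; exact div_nonneg (entropy_nonneg ν n) n.cast_nonneg⟩

/-- Monotonicity under doubling makes the sets `A k` in `isLUB_entropyRate` nested. -/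
lemma entropy_two_mul_div_le {ν : ProbabilityMeasure CantorSpace}
    (hν : MeasurePreserving shift (ν : Measure CantorSpace) (ν : Measure CantorSpace)) (n : ℕ) :
    entropy ν (2 * n) / (2 * n : ℕ) ≤ entropy ν n / n := by
  have h := subadditive_entropy hν n n
  rw [← two_mul] at h
  push_cast
  rw [mul_comm (2 : ℝ), ← div_div, div_right_comm]
  refine div_le_div_of_nonneg_right ?_ n.cast_nonneg
  linarith

/-! ### The lift of the image of a shift-invariant measure -/

/-- The digits before `i` contribute at most `1 - 2⁻ⁱ` and those after it at most half of `2⁻ⁱ`. -/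
lemma ofDigits_lt_one {y : CantorSpace} {i : ℕ} (hi : y i = 0) : Real.ofDigits y < 1 := by
  have h := Real.ofDigits_eq_sum_add_ofDigits y (i + 1)
  have hle := Real.ofDigits_le_one fun j => y (j + (i + 1))
  have hw := wordVal_add_le_one fun j : Fin i => y j
  have h0 : Real.ofDigitsTerm y i = 0 := by simp [Real.ofDigitsTerm, hi]
  rw [wordVal_restrict] at hw
  rw [Finset.sum_range_succ, h0, add_zero] at h
  have hp : (0 : ℝ) < (1 / 2) ^ i := by positivity
  have hpow : (((2 : ℕ) : ℝ) ^ (i + 1))⁻¹ = (1 / 2) ^ i / 2 := by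
    push_cast
    rw [pow_succ, mul_inv, one_div, inv_pow]
    ring
  rw [hpow] at h
  nlinarith

lemma val_mem_dyadic {y : CantorSpace} {l i : ℕ} (hl : l ≤ i) (hi : y i = 0) :
    val y ∈ dyadic (pref y l) := by
  refine ⟨Real.ofDigits y, ?_, rfl⟩
  have h := Real.ofDigits_eq_sum_add_ofDigits y l
  have h0 := Real.ofDigits_nonneg fun j => y (j + l)
  have h1 : Real.ofDigits (fun j => y (j + l)) < 1 :=
    ofDigits_lt_one (i := i - l) (by rwa [Nat.sub_add_cancel hl])
  have hpow : (((2 : ℕ) : ℝ) ^ l)⁻¹ = (1 / 2) ^ l := by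
    push_cast
    rw [one_div, inv_pow]
  have hp : (0 : ℝ) < (1 / 2) ^ l := by positivity
  rw [show pref y l = fun j : Fin l => y j from rfl, wordVal_restrict]
  rw [hpow] at h
  constructor <;> nlinarith

/-- With zeros arbitrarily far out, `y` has the same prefixes as the canonical expansion of `val y`.
-/
lemma val_mem_dyadic_iff {y : CantorSpace} (hy : ∀ l, ∃ i, l ≤ i ∧ y i = 0) {l : ℕ} (w : Word l) :
    val y ∈ dyadic w ↔ y ∈ cyl w := by
  obtain ⟨i, hl, hi⟩ := hy l
  have h := (expansion_mem_cyl _ _).2 (val_mem_dyadic hl hi)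
  rw [← expansion_mem_cyl]
  exact ⟨fun h' j => (h j).symm.trans (h' j), fun h' j => (h j).trans (h' j)⟩

lemma val_one : val (fun _ => 1) = 0 := by
  have h : Real.ofDigits (fun _ : ℕ => (1 : Fin 2)) = 1 := Real.ofDigits_const_last_eq_one 1
  rw [val, h]
  exact AddCircle.coe_period 1

lemma wordVal_zero (l : ℕ) : wordVal (fun _ : Fin l => 0) = 0 := by
  simp [wordVal]

lemma zero_mem_dyadic_iff {l : ℕ} (w : Word l) : (0 : Torus) ∈ dyadic w ↔ w = fun _ => 0 := by
  have h : expansion 0 ∈ cyl fun _ : Fin l => (0 : Fin 2) :=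
    (expansion_mem_cyl _ _).2 ⟨0, ⟨(wordVal_zero l).le, by rw [wordVal_zero]; positivity⟩, rfl⟩
  rw [← expansion_mem_cyl]
  constructor
  · exact fun h' => funext fun i => (h' i).symm.trans (h i)
  · rintro rfl
    exact h

/-- A shift-invariant measure has no mass on the sequences that end in ones but are not
constant. -/
lemma ae_infinitely_many_zeros {ν : ProbabilityMeasure CantorSpace}
    (hν : MeasurePreserving shift (ν : Measure CantorSpace) (ν : Measure CantorSpace)) :
    ∀ᵐ y ∂(ν : Measure CantorSpace), (y = fun _ => 1) ∨ ∀ l, ∃ i, l ≤ i ∧ y i = 0 := by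
  -- The preimage contains the constant sequence and has, by invariance, the same finite measure as
  -- its singleton.
  have hnull (l : ℕ) : (ν : Measure CantorSpace)
      (shift^[l] ⁻¹' {fun _ => 1} \ {fun _ => 1}) = 0 := by
    have hsub : {fun _ => 1} ⊆ shift^[l] ⁻¹' {(fun _ => 1 : CantorSpace)} := by
      rintro _ rfl
      exact funext fun i => shift_iterate _ l i
    rw [measure_sdiff hsub (measurableSet_singleton _).nullMeasurableSet (measure_ne_top _ _),
      (hν.iterate l).measure_preimage (measurableSet_singleton _).nullMeasurableSet, tsub_self]
  have hae : ∀ᵐ y ∂(ν : Measure CantorSpace), ∀ l,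
      y ∉ shift^[l] ⁻¹' {fun _ => 1} \ {fun _ => 1} :=
    ae_all_iff.2 fun l => measure_eq_zero_iff_ae_notMem.1 (hnull l)
  filter_upwards [hae] with y hy
  by_contra! hcon
  obtain ⟨h1, l, hl⟩ := hcon
  refine hy l ⟨funext fun i => ?_, h1⟩
  rw [shift_iterate]
  have := hl (i + l) (by omega)
  omega

/-- The only possible loss is an atom at the constant sequence of ones: `val` sends it to `0`, and
the lift puts its mass on the constant sequence of zeros. -/
lemma lift_toTorus_cyl {ν : ProbabilityMeasure CantorSpace}
    (hν : MeasurePreserving shift (ν : Measure CantorSpace) (ν : Measure CantorSpace))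
    {l : ℕ} {w : Word l} (h0 : w ≠ fun _ => 0) (h1 : w ≠ fun _ => 1) :
    (lift (toTorus ν) : Measure CantorSpace).real (cyl w) =
      (ν : Measure CantorSpace).real (cyl w) := by
  have hdyadic : MeasurableSet (dyadic w) := by
    have h : dyadic w = expansion ⁻¹' cyl w := Set.ext fun y => (expansion_mem_cyl w y).symm
    rw [h]
    exact measurable_expansion (measurableSet_cyl w)
  rw [Measure.real, Measure.real, lift_cyl, toTorus, ProbabilityMeasure.toMeasure_map,
    Measure.map_apply continuous_val.measurable hdyadic]
  congr 1
  refine measure_congr ?_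
  filter_upwards [ae_infinitely_many_zeros hν] with y hy
  refine propext ?_
  rcases hy with rfl | hy
  · have hv : ¬ val (fun _ => 1) ∈ dyadic w := by rwa [val_one, zero_mem_dyadic_iff]
    refine iff_of_false hv fun h => h1 (funext fun i => (h i).symm)
  · exact val_mem_dyadic_iff hy w

/-- On `[0, 1]` the function `negMulLog` takes values in `[0, 1]`, so each exceptional word costs at
most `1 / log 2`. -/
lemma abs_entropy_sub_le {ν ν' : ProbabilityMeasure CantorSpace} {n : ℕ} (s : Finset (Word n))
    (h : ∀ w ∉ s, (ν' : Measure CantorSpace).real (cyl w) =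
      (ν : Measure CantorSpace).real (cyl w)) :
    |entropy ν' n - entropy ν n| ≤ s.card / Real.log 2 := by
  have hlog : 0 < Real.log 2 := Real.log_pos (by norm_num)
  rw [entropy_eq_sum_negMulLog, entropy_eq_sum_negMulLog, ← sub_div, abs_div, abs_of_pos hlog,
    ← Finset.sum_sub_distrib]
  refine div_le_div_of_nonneg_right ?_ hlog.le
  rw [← Finset.sum_subset (Finset.subset_univ s) fun w _ hw => by rw [h w hw, sub_self]]
  have hbound (ρ : ProbabilityMeasure CantorSpace) (w : Word n) :
      0 ≤ Real.negMulLog ((ρ : Measure CantorSpace).real (cyl w)) ∧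
        Real.negMulLog ((ρ : Measure CantorSpace).real (cyl w)) ≤ 1 :=
    ⟨Real.negMulLog_nonneg measureReal_nonneg measureReal_le_one,
      (Real.negMulLog_le_one_sub_self measureReal_nonneg).trans (sub_le_self _ measureReal_nonneg)⟩
  refine (Finset.abs_sum_le_sum_abs _ _).trans ((Finset.sum_le_card_nsmul s _ 1 fun w _ => ?_).trans
    (by simp))
  rw [abs_le]
  constructor <;> linarith [(hbound ν w).1, (hbound ν w).2, (hbound ν' w).1, (hbound ν' w).2]

/-- The entropy rate of a shift-invariant measure. -/
def entropyRate (ν : ProbabilityMeasure CantorSpace) : ℝ :=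
  limUnder atTop fun n : ℕ => entropy ν n / n

lemma tendsto_entropyRate {ν : ProbabilityMeasure CantorSpace}
    (hν : MeasurePreserving shift (ν : Measure CantorSpace) (ν : Measure CantorSpace)) :
    Tendsto (fun n : ℕ => entropy ν n / n) atTop (𝓝 (entropyRate ν)) :=
  tendsto_nhds_limUnder ⟨_, (subadditive_entropy hν).tendsto_lim (bddBelow_entropy_div ν)⟩

/-- The limit in Fekete's lemma is the infimum over `n ≥ 1`. -/
lemma entropyRate_le {ν : ProbabilityMeasure CantorSpace}
    (hν : MeasurePreserving shift (ν : Measure CantorSpace) (ν : Measure CantorSpace))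
    {n : ℕ} (hn : n ≠ 0) : entropyRate ν ≤ entropy ν n / n := by
  rw [tendsto_nhds_unique (tendsto_entropyRate hν)
    ((subadditive_entropy hν).tendsto_lim (bddBelow_entropy_div ν))]
  exact (subadditive_entropy hν).lim_le_div (bddBelow_entropy_div ν) hn

lemma tendsto_entropy_lift {ν : ProbabilityMeasure CantorSpace}
    (hν : MeasurePreserving shift (ν : Measure CantorSpace) (ν : Measure CantorSpace)) :
    Tendsto (fun n : ℕ => entropy (lift (toTorus ν)) n / n) atTop (𝓝 (entropyRate ν)) := by
  have hlog : 0 < Real.log 2 := Real.log_pos (by norm_num)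
  have hdiff : Tendsto (fun n : ℕ => (entropy (lift (toTorus ν)) n - entropy ν n) / n) atTop
      (𝓝 0) := by
    refine squeeze_zero_norm (fun n => ?_) (tendsto_const_div_atTop_nhds_zero_nat (2 / Real.log 2))
    rw [norm_div, Real.norm_natCast, Real.norm_eq_abs]
    refine div_le_div_of_nonneg_right ?_ n.cast_nonneg
    refine (abs_entropy_sub_le {fun _ => 0, fun _ => 1} fun w hw => ?_).trans
      (div_le_div_of_nonneg_right (by exact_mod_cast Finset.card_le_two) hlog.le)
    simp only [Finset.mem_insert, Finset.mem_singleton, not_or] at hw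
    exact lift_toTorus_cyl hν hw.1 hw.2
  have h := hdiff.add (tendsto_entropyRate hν)
  rw [zero_add] at h
  refine h.congr fun n => ?_
  ring

lemma lowerEntropy_lift {ν : ProbabilityMeasure CantorSpace}
    (hν : MeasurePreserving shift (ν : Measure CantorSpace) (ν : Measure CantorSpace)) :
    lowerEntropy (lift (toTorus ν)) = entropyRate ν :=
  (tendsto_entropy_lift hν).liminf_eq

lemma upperEntropy_lift {ν : ProbabilityMeasure CantorSpace}
    (hν : MeasurePreserving shift (ν : Measure CantorSpace) (ν : Measure CantorSpace)) :
    upperEntropy (lift (toTorus ν)) = entropyRate ν :=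
  (tendsto_entropy_lift hν).limsup_eq

lemma image_liftedWeylLimits (x : CantorSpace) {H : ProbabilityMeasure CantorSpace → ℝ}
    (hH : ∀ ν : ProbabilityMeasure CantorSpace,
      MeasurePreserving shift (ν : Measure CantorSpace) (ν : Measure CantorSpace) →
        H (lift (toTorus ν)) = entropyRate ν) :
    H '' liftedWeylLimits x = entropyRate '' {ν | MapClusterPt ν atTop (empirical x)} := by
  rw [liftedWeylLimits, weylLimits_eq, Set.image_image, Set.image_image]
  exact Set.image_congr fun ν hν => hH ν (measurePreserving_shift_of_mapClusterPt hν)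

/-! ### The variational principles -/

/-- Provides the lower bound that `ciInf_le` needs for the real infimum over block lengths. -/
lemma liminf_entropy_nonneg (x : CantorSpace) (l : ℕ) :
    0 ≤ liminf (fun n => entropy (empirical x n) l / l) atTop :=
  le_liminf_of_le
    (isBoundedUnder_le_comp ((continuous_entropy l).div_const _)).isCoboundedUnder_ge
    (Eventually.of_forall fun _ => div_nonneg (entropy_nonneg _ l) l.cast_nonneg)

lemma limsup_entropy_nonneg (x : CantorSpace) (l : ℕ) :
    0 ≤ limsup (fun n => entropy (empirical x n) l / l) atTop :=
  (liminf_entropy_nonneg x l).trans (liminf_le_limsup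
    (isBoundedUnder_le_comp ((continuous_entropy l).div_const _))
    (isBoundedUnder_ge_comp ((continuous_entropy l).div_const _)))

theorem isGLB_entropyRate (x : CantorSpace) :
    IsGLB (entropyRate '' {ν | MapClusterPt ν atTop (empirical x)}) (finiteStateDim x) := by
  simp_rw [finiteStateDim, liminf_blockEntropy]
  have hcont (l : ℕ) := (continuous_entropy l).div_const (l : ℝ)
  constructor
  · rintro _ ⟨ν, hν, rfl⟩
    -- The dimension is at most `entropy ν l / l` for every `l ≥ 1`; then `l` tends to infinity.
    refine ge_of_tendsto (tendsto_entropyRate (measurePreserving_shift_of_mapClusterPt hν)) ?_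
    filter_upwards [eventually_gt_atTop 0] with l hl
    refine (ciInf_le ⟨0, ?_⟩ (⟨l, hl⟩ : ℕ+)).trans (liminf_le_of_mapClusterPt (hcont l) hν)
    rintro _ ⟨m, rfl⟩
    exact liminf_entropy_nonneg x m
  · intro b hb
    refine le_ciInf fun l => le_of_forall_gt_imp_ge_of_dense fun c hc => ?_
    obtain ⟨ν, hνc, hν⟩ := exists_mapClusterPt_le (hcont l) hc
    exact (hb ⟨ν, hν, rfl⟩).trans
      ((entropyRate_le (measurePreserving_shift_of_mapClusterPt hν) l.ne_zero).trans hνc)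

theorem isLUB_entropyRate (x : CantorSpace) :
    IsLUB (entropyRate '' {ν | MapClusterPt ν atTop (empirical x)}) (finiteStateStrongDim x) := by
  simp_rw [finiteStateStrongDim, limsup_blockEntropy]
  have hcont (l : ℕ) := (continuous_entropy l).div_const (l : ℝ)
  constructor
  · rintro _ ⟨ν, hν, rfl⟩
    exact le_ciInf fun l => (entropyRate_le (measurePreserving_shift_of_mapClusterPt hν) l.ne_zero).trans
      (le_limsup_of_mapClusterPt (hcont l) hν)
  · intro b hb
    refine le_of_forall_lt_imp_le_of_dense fun c hc => ?_
    -- Each block length yields its own cluster point with large entropy, but one `ν` must serve all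
    -- of them. The `A k` are nonempty, compact and decreasing, so Cantor's intersection theorem
    -- gives it.
    let A : ℕ → Set (ProbabilityMeasure CantorSpace) := fun k =>
      {ν | MapClusterPt ν atTop (empirical x)} ∩ {ν | c ≤ entropy ν (2 ^ k) / (2 ^ k : ℕ)}
    have hclosed (k : ℕ) : IsClosed (A k) :=
      isClosed_setOfPred_clusterPt.inter (isClosed_le continuous_const (hcont _))
    obtain ⟨ν, hνA⟩ := IsCompact.nonempty_iInter_of_sequence_nonempty_isCompact_isClosed A
      (fun k ν hν => ⟨hν.1, by
        have h := entropy_two_mul_div_le (measurePreserving_shift_of_mapClusterPt hν.1) (2 ^ k)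
        rw [← pow_succ'] at h
        exact le_trans hν.2 h⟩)
      (fun k => by
        have hk : c < limsup (fun n => entropy (empirical x n) (2 ^ k) / (2 ^ k : ℕ)) atTop := by
          refine hc.trans_le (ciInf_le ⟨0, ?_⟩ (⟨2 ^ k, by positivity⟩ : ℕ+))
          rintro _ ⟨m, rfl⟩
          exact limsup_entropy_nonneg x m
        obtain ⟨ν, hνc, hν⟩ := exists_mapClusterPt_ge (hcont (2 ^ k)) hk
        exact ⟨ν, hν, hνc⟩)
      (hclosed 0).isCompact hclosed
    rw [Set.mem_iInter] at hνA
    have hν := (hνA 0).1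
    refine le_trans ?_ (hb ⟨ν, hν, rfl⟩)
    exact ge_of_tendsto' ((tendsto_entropyRate (measurePreserving_shift_of_mapClusterPt hν)).comp
      (tendsto_pow_atTop_atTop_of_one_lt one_lt_two)) fun k => (hνA k).2

end WeylFSD

end

/-- In `ℝ` the empty set has no greatest lower bound, so `IsGLB` also carries the non-emptiness of
the set of lifts. -/
theorem mainTheorem1 (x : WeylFSD.CantorSpace) :
    (∀ (n : ℕ → ℕ) (c : ℤ → ℂ), StrictMono n →
        (∀ k : ℤ, Tendsto (fun m : ℕ => WeylFSD.weylAverage x k (n m)) atTop (𝓝 (c k))) →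
        ∃ μ : ProbabilityMeasure WeylFSD.Torus,
          ∀ k : ℤ, c k = WeylFSD.fourierCoefficient μ k) ∧
      IsGLB (WeylFSD.lowerEntropy '' WeylFSD.liftedWeylLimits x) (WeylFSD.finiteStateDim x) ∧
      IsLUB (WeylFSD.upperEntropy '' WeylFSD.liftedWeylLimits x)
        (WeylFSD.finiteStateStrongDim x) := by
  refine ⟨fun n c hn hc => ?_, ?_, ?_⟩
  · obtain ⟨ν, -, hν⟩ := WeylFSD.exists_mapClusterPt_of_tendsto hn hc
    exact ⟨WeylFSD.toTorus ν, fun k => (hν k).symm⟩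
  · rw [WeylFSD.image_liftedWeylLimits x fun _ => WeylFSD.lowerEntropy_lift]
    exact WeylFSD.isGLB_entropyRate x
  · rw [WeylFSD.image_liftedWeylLimits x fun _ => WeylFSD.upperEntropy_lift]
    exact WeylFSD.isLUB_entropyRate x
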